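/- Let $\mathbb{K}$ be a perfect field with algebraic closure $\overline{\mathbb{K}}$, let $0\le s\le n$, and let $V\subset\mathbb{A}^n=\overline{\mathbb{K}}^n$ be an equidimensional $\mathbb{K}$-variety of dimension $n-s$ (the set of common zeros in $\overline{\mathbb{K}}^n$ of polynomials with coefficients in $\mathbb{K}$, all of whose irreducible components over $\mathbb{K}$ have dimension $n-s$). Suppose that $F_1,\dots,F_s\in\mathbb{K}[X_1,\dots,X_n]$ generate the vanishing ideal $\mathcal{I}(V)\subset\mathbb{K}[X_1,\dots,X_n]$ of $V$, and let $\mathbb{K}[V]=\mathbb{K}[X_1,\dots,X_n]/\mathcal{I}(V)$. Let $Y_1,\dots,Y_{n-s}\in\mathbb{K}[X_1,\dots,X_n]$ be linear forms such that $\pi=(Y_1,\dots,Y_{n-s}):V\to\mathbb{A}^{n-s}$ is a finite morphism, and assume that $\mathbb{K}[V]$ is a free module of finite rank $D$ over $R=\mathbb{K}[Y_1,\dots,Y_{n-s}]$ (acting through $\pi$). Let $J$ be the Jacobian determinant of $Y_1,\dots,Y_{n-s},F_1,\dots,F_s$ with respect to $X_1,\dots,X_n$. For $\mathbf{p}=(p_1,\dots,p_{n-s})\in\mathbb{K}^{n-s}$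 let $\pi^{-1}(\mathbf{p})\subset V$ be the fiber, consisting of points with coordinates in $\overline{\mathbb{K}}$, and call $\mathbf{p}$ a lifting point if $J(\mathbf{x})\ne0$ for every $\mathbf{x}\in\pi^{-1}(\mathbf{p})$. Then for every $\mathbf{p}\in\mathbb{K}^{n-s}$ one has $\#\pi^{-1}(\mathbf{p})\le D$, and the following three conditions are equivalent: (i) $\#\pi^{-1}(\mathbf{p})=D$; (ii) $\mathbf{p}$ is a lifting point; (iii) the ideal $(F_1,\dots,F_s,Y_1-p_1,\dots,Y_{n-s}-p_{n-s})$ of $\mathbb{K}[X_1,\dots,X_n]$ is radical. -/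

import Mathlib

open MvPolynomial

namespace LiftingFiber

noncomputable section

/-- The affine space `𝔸ⁿ` over the algebraic closure of `K`. -/
abbrev AffSpace (K : Type*) [Field K] (n : ℕ) : Type _ := Fin n → AlgebraicClosure K

/-- `V ⊆ 𝔸ⁿ` is a `K`-variety: the set of common zeros, with coordinates in the algebraic closure
of `K`, of a set of polynomials with coefficients in `K`. -/
def IsKVariety {K : Type*} [Field K] {n : ℕ} (V : Set (AffSpace K n)) : Prop :=
  ∃ S : Set (MvPolynomial (Fin n) K), V = {x | ∀ f ∈ S, aeval x f = 0}

/-- The coordinate ring `K[V] = K[X₁, …, Xₙ] / I(V)`, where `I(V)` is the ideal of the polynomials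
with coefficients in `K` that vanish on `V`. -/
abbrev CoordRing {K : Type*} [Field K] {n : ℕ} (V : Set (AffSpace K n)) : Type _ :=
  MvPolynomial (Fin n) K ⧸ vanishingIdeal K V

/-- `V` has dimension `d`, and so has each of its irreducible components over `K`. The components
correspond to the minimal primes over `I(V)`; the dimension is the Krull dimension of the coordinate
ring. The empty set has dimension `⊥`, so it is excluded. -/
def IsEquidimensional {K : Type*} [Field K] {n : ℕ} (V : Set (AffSpace K n)) (d : ℕ) : Prop :=
  ringKrullDim (CoordRing V) = d ∧
    ∀ P ∈ (vanishingIdeal K V).minimalPrimes, ringKrullDim (MvPolynomial (Fin n) K ⧸ P) = d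

/-- The homomorphism `K[Y₁, …, Y_d] → K[V]` dual to the map `π : V → 𝔸ᵈ`,
`x ↦ (Y₁(x), …, Y_d(x))`, given by polynomials `Y₁, …, Y_d ∈ K[X₁, …, Xₙ]`. -/
def comorphism {K : Type*} [Field K] {n d : ℕ} (V : Set (AffSpace K n))
    (Y : Fin d → MvPolynomial (Fin n) K) : MvPolynomial (Fin d) K →+* CoordRing V :=
  (aeval (R := K) fun i => Ideal.Quotient.mk (vanishingIdeal K V) (Y i)).toRingHom

/-- `B`, viewed as an `A`-module through `φ : A → B`, is free of finite rank `D`. -/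
def IsFreeOfRank {A B : Type*} [CommRing A] [CommRing B] (φ : A →+* B) (D : ℕ) : Prop :=
  letI : Module A B := φ.toModule
  Module.Free A B ∧ Module.Finite A B ∧ Module.finrank A B = D

/-- The fiber `π⁻¹(p)` of the map `π : V → 𝔸ᵈ` defined by `Y₁, …, Y_d`: all its points with
coordinates in the algebraic closure of `K`. -/
def fiber {K : Type*} [Field K] {n d : ℕ} (V : Set (AffSpace K n))
    (Y : Fin d → MvPolynomial (Fin n) K) (p : Fin d → K) : Set (AffSpace K n) :=
  {x | x ∈ V ∧ ∀ i, aeval x (Y i) = algebraMap K (AlgebraicClosure K) (p i)}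

/-- The Jacobian determinant of `Y₁, …, Y_d, F₁, …, F_s` with respect to `X₁, …, Xₙ`,
where `n = d + s`. -/
def jacobianDet {K : Type*} [Field K] {d s : ℕ} (Y : Fin d → MvPolynomial (Fin (d + s)) K)
    (F : Fin s → MvPolynomial (Fin (d + s)) K) : MvPolynomial (Fin (d + s)) K :=
  (Matrix.of fun i j : Fin (d + s) => pderiv j (Fin.append Y F i)).det

/-- `p` is a lifting point of `π : V → 𝔸ᵈ` with respect to the system `F₁ = 0, …, F_s = 0`. -/
def IsLiftingPoint {K : Type*} [Field K] {d s : ℕ} (V : Set (AffSpace K (d + s)))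
    (F : Fin s → MvPolynomial (Fin (d + s)) K) (Y : Fin d → MvPolynomial (Fin (d + s)) K)
    (p : Fin d → K) : Prop :=
  ∀ x ∈ fiber V Y p, aeval x (jacobianDet Y F) ≠ 0

/-- The ideal `(F₁, …, F_s, Y₁ - p₁, …, Y_d - p_d)` of `K[X₁, …, Xₙ]`. -/
def fiberIdeal {K : Type*} [Field K] {n d s : ℕ} (F : Fin s → MvPolynomial (Fin n) K)
    (Y : Fin d → MvPolynomial (Fin n) K) (p : Fin d → K) : Ideal (MvPolynomial (Fin n) K) :=
  Ideal.span (Set.range F) ⊔ Ideal.span (Set.range fun i => Y i - C (p i))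

end

end LiftingFiber

/-! Let `A` be the quotient of the polynomial ring by the fiber ideal. It is the base change of
`K[V]` along evaluation at `p`, so freeness gives it dimension exactly `D` over `K`
(`finite_and_finrank_fiberIdeal`). Points of the fiber are the `K`-algebra maps from `A` to the
algebraic closure (`encard_fiber`), and independence of characters bounds their number by `D`. Each
of the three conditions says that `A` is unramified over `K`. For lifting points this is the
Jacobian criterion, applied to a system of `n` equations in `n` unknowns. For radicality, a finite
reduced algebra over a perfect field is a product of separable extensions. For the count, equality
makes the characters span all linear maps, which forces `A` to be reduced; conversely, an unramified
`A` splits completely over the algebraic closure. -/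

namespace LiftingFiber

/-! ### Counting the characters of a finite algebra over a field. -/

section FiniteAlgebra

open TensorProduct

variable {K A : Type*} [Field K] [CommRing A] [Algebra K A] [Module.Finite K A]

theorem encard_algHom_le_finrank (L : Type*) [Field L] [Algebra K L] :
    (Set.univ : Set (A →ₐ[K] L)).encard ≤ Module.finrank K A := by
  have := (linearIndependent_toLinearMap K A L).finite
  have := Fintype.ofFinite (A →ₐ[K] L)
  have h := (linearIndependent_toLinearMap K A L).fintype_card_le_finrank
  rw [Module.finrank_linearMap_self] at h
  rw [Set.encard_univ, ENat.card_eq_coe_fintype_card]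
  exact_mod_cast h

/-- With this many independent characters, they span `A →ₗ[K] L`. A nilpotent is killed by every
character, hence by every linear map. -/
theorem isReduced_of_encard_algHom_eq {L : Type*} [Field L] [Algebra K L]
    (h : (Set.univ : Set (A →ₐ[K] L)).encard = Module.finrank K A) : IsReduced A := by
  have := (linearIndependent_toLinearMap K A L).finite
  have := Fintype.ofFinite (A →ₐ[K] L)
  rw [Set.encard_univ, ENat.card_eq_coe_fintype_card] at h
  have hcard : Fintype.card (A →ₐ[K] L) = Module.finrank L (A →ₗ[K] L) := by
    rw [Module.finrank_linearMap_self]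
    exact_mod_cast h
  have hspan := (linearIndependent_toLinearMap K A L).span_eq_top_of_card_eq_finrank' hcard
  refine ⟨fun a ha => ?_⟩
  have hker (f : A →ₗ[K] L) : f a = 0 := by
    have hf : f ∈ Submodule.span L (Set.range (AlgHom.toLinearMap : (A →ₐ[K] L) → A →ₗ[K] L)) :=
      hspan ▸ Submodule.mem_top
    induction hf using Submodule.span_induction with
    | mem f hf =>
      obtain ⟨g, rfl⟩ := hf
      exact (ha.map g).eq_zero
    | zero => rfl
    | add f g _ _ hf hg => simp [hf, hg]
    | smul c f _ hf => simp [hf]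
  -- Functionals with values in `K`, composed with `K → L`, already separate the elements of `A`.
  refine (Module.forall_dual_apply_eq_zero_iff K a).mp fun f => ?_
  have := hker ((Algebra.linearMap K L).comp f)
  simpa using this

theorem formallyUnramified_of_isReduced [PerfectField K] [IsReduced A] :
    Algebra.FormallyUnramified K A := by
  have : IsArtinianRing A := .of_finite K A
  have (I : MaximalSpectrum A) : Algebra.FormallyEtale K (A ⧸ I.asIdeal) := by
    let := Ideal.Quotient.field I.asIdeal
    exact Algebra.FormallyEtale.of_isSeparable K _
  have := Algebra.FormallyEtale.of_equiv
    ((IsArtinianRing.equivPi A).restrictScalars K).symm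
  infer_instance

/-- After base change to `L` the algebra becomes a power of `L`; its coordinate projections restrict
to distinct characters of `A`. -/
theorem encard_algHom_eq_finrank [Algebra.FormallyUnramified K A] (L : Type*) [Field L]
    [Algebra K L] [IsSepClosed L] :
    (Set.univ : Set (A →ₐ[K] L)).encard = Module.finrank K A := by
  refine le_antisymm (encard_algHom_le_finrank L) ?_
  have := Algebra.FormallyEtale.of_formallyUnramified_of_field L (L ⊗[K] A)
  let e := Algebra.FormallyEtale.equivPiOfIsSepClosed L (L ⊗[K] A)
  have : IsArtinianRing (L ⊗[K] A) := .of_finite L _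
  have := Fintype.ofFinite (PrimeSpectrum (L ⊗[K] A))
  have hcard : Module.finrank K A = Fintype.card (PrimeSpectrum (L ⊗[K] A)) := by
    rw [← Module.finrank_baseChange (R := L), e.toLinearEquiv.finrank_eq, Module.finrank_pi]
  let ev (q : PrimeSpectrum (L ⊗[K] A)) : A →ₐ[K] L :=
    (((Pi.evalAlgHom L (fun _ => L) q).comp e.toAlgHom).restrictScalars K).comp
      Algebra.TensorProduct.includeRight
  have hev : Function.Injective ev := by
    intro q r hqr
    have h : (Pi.evalAlgHom L (fun _ => L) q).comp e.toAlgHom =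
        (Pi.evalAlgHom L (fun _ => L) r).comp e.toAlgHom :=
      Algebra.TensorProduct.ext (by ext) hqr
    classical
    by_contra hne
    have := DFunLike.congr_fun h (e.symm (Pi.single q 1))
    simp [Ne.symm hne] at this
  rw [hcard, Set.encard_univ, ← ENat.card_eq_coe_fintype_card]
  exact ENat.card_le_card_of_injective hev

end FiniteAlgebra

/-! ### The Jacobian criterion for square systems. -/

section Jacobian

variable {K σ : Type*} [Field K] [Fintype σ] [DecidableEq σ]

theorem derivation_eq_sum_pderiv {M : Type*} [AddCommGroup M] [Module K M]
    [Module (MvPolynomial σ K) M] [IsScalarTower K (MvPolynomial σ K) M]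
    (δ : Derivation K (MvPolynomial σ K) M) (f : MvPolynomial σ K) :
    δ f = ∑ j, pderiv j f • δ (X j) := by
  have hsum (E : σ → Derivation K (MvPolynomial σ K) M) (g : MvPolynomial σ K) :
      (∑ j, E j) g = ∑ j, E j g := by
    have := congrFun (map_sum Derivation.coeFnAddMonoidHom E Finset.univ) g
    rw [Finset.sum_apply] at this
    exact this
  have : δ = ∑ j, (LinearMap.toSpanSingleton (MvPolynomial σ K) M (δ (X j))).compDer
      (pderiv j) := by
    ext i
    simp [hsum, pderiv_X, Pi.single_apply, ite_smul]
  conv_lhs => rw [this]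
  simp [hsum]

variable (G : σ → MvPolynomial σ K)

theorem formallyUnramified_of_aeval_det_ne_zero {L : Type*} [Field L] [Algebra K L]
    [IsAlgClosed L]
    (hG : ∀ x : σ → L, (∀ i, aeval x (G i) = 0) →
      aeval x (Matrix.of fun i j => pderiv j (G i)).det ≠ 0) :
    Algebra.FormallyUnramified K (MvPolynomial σ K ⧸ Ideal.span (Set.range G)) := by
  set I := Ideal.span (Set.range G)
  set M : Matrix σ σ (MvPolynomial σ K) := Matrix.of fun i j => pderiv j (G i)
  -- Nullstellensatz: the equations and the Jacobian determinant have no common zero, so the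
  -- determinant is a unit in the quotient.
  have htop : I ⊔ Ideal.span {M.det} = ⊤ := by
    rw [← Ideal.radical_eq_top, ← vanishingIdeal_zeroLocus_eq_radical (K := L),
      Ideal.eq_top_iff_one]
    intro x hx
    refine absurd (hx _ (Ideal.mem_sup_right (Ideal.mem_span_singleton_self _))) (hG x ?_)
    exact fun i => hx _ (Ideal.mem_sup_left (Ideal.subset_span ⟨i, rfl⟩))
  have hunit : IsUnit (Ideal.Quotient.mk I M.det) := by
    rw [← Ideal.span_singleton_eq_top, ← Set.image_singleton, ← Ideal.map_span]
    have := congrArg (Ideal.map (Ideal.Quotient.mk I)) htop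
    rwa [Ideal.map_sup, Ideal.map_quotient_self, bot_sup_eq, Ideal.map_top] at this
  let δ := (KaehlerDifferential.D K (MvPolynomial σ K ⧸ I)).compAlgebraMap (MvPolynomial σ K)
  have hδ (f : MvPolynomial σ K) : δ f = KaehlerDifferential.D K _ (Ideal.Quotient.mk I f) := rfl
  have hδG (i : σ) : ∑ j, M i j • δ (X j) = 0 := by
    have := derivation_eq_sum_pderiv δ (G i)
    rw [hδ, Ideal.Quotient.eq_zero_iff_mem.mpr (Ideal.subset_span (Set.mem_range_self i)),
      map_zero] at this
    exact this.symm
  -- Cramer's rule: multiply the relations `dG i = 0` by the adjugate matrix.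
  have hdet (k : σ) : M.det • δ (X k) = 0 := by
    calc M.det • δ (X k) = ∑ j, (M.adjugate * M) k j • δ (X j) := by
          simp [Matrix.adjugate_mul, Matrix.one_apply, ite_smul]
      _ = ∑ i, M.adjugate k i • ∑ j, M i j • δ (X j) := by
          simp only [Matrix.mul_apply, Finset.sum_smul, Finset.smul_sum, mul_smul]
          exact Finset.sum_comm
      _ = 0 := by simp [hδG]
  have hX (k : σ) : δ (X k) = 0 := by
    have := hdet k
    rw [← algebraMap_smul (MvPolynomial σ K ⧸ I)] at this
    exact hunit.smul_eq_zero.mp this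
  refine ⟨subsingleton_of_forall_eq 0 fun ω => ?_⟩
  have hω : ω ∈ Submodule.span (MvPolynomial σ K ⧸ I)
      (Set.range (KaehlerDifferential.D K (MvPolynomial σ K ⧸ I))) := by
    rw [KaehlerDifferential.span_range_derivation]
    trivial
  have hbot : Submodule.span (MvPolynomial σ K ⧸ I)
      (Set.range (KaehlerDifferential.D K (MvPolynomial σ K ⧸ I))) = ⊥ := by
    rw [Submodule.span_eq_bot]
    rintro _ ⟨a, rfl⟩
    obtain ⟨f, rfl⟩ := Ideal.Quotient.mk_surjective a
    rw [← hδ, derivation_eq_sum_pderiv]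
    simp [hX]
  rwa [hbot, Submodule.mem_bot] at hω

/-- A kernel vector of the Jacobian matrix at `x` is a tangent vector: it gives a nonzero derivation
of the quotient into `L`, which is impossible when the differentials vanish. -/
theorem aeval_det_ne_zero_of_formallyUnramified {L : Type*} [Field L] [Algebra K L]
    [Algebra.FormallyUnramified K (MvPolynomial σ K ⧸ Ideal.span (Set.range G))]
    {x : σ → L} (hx : ∀ i, aeval x (G i) = 0) :
    aeval x (Matrix.of fun i j => pderiv j (G i)).det ≠ 0 := by
  set I := Ideal.span (Set.range G)
  intro hdet
  rw [AlgHom.map_det] at hdet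
  obtain ⟨v, hv, hMv⟩ := Matrix.exists_mulVec_eq_zero_iff.mpr hdet
  have hI : ∀ f ∈ I, aeval x f = 0 := fun f hf => by
    have : I ≤ RingHom.ker (aeval x : MvPolynomial σ K →ₐ[K] L) :=
      Ideal.span_le.mpr (by rintro _ ⟨i, rfl⟩; exact hx i)
    exact this hf
  let φ : (MvPolynomial σ K ⧸ I) →ₐ[K] L := Ideal.Quotient.liftₐ I (aeval x) hI
  let : Algebra (MvPolynomial σ K) L := (aeval x : MvPolynomial σ K →ₐ[K] L).toAlgebra
  let : Algebra (MvPolynomial σ K ⧸ I) L := φ.toAlgebra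
  have : IsScalarTower K (MvPolynomial σ K) L :=
    .of_algebraMap_eq fun a => ((aeval x : MvPolynomial σ K →ₐ[K] L).commutes a).symm
  have : IsScalarTower K (MvPolynomial σ K ⧸ I) L :=
    .of_algebraMap_eq fun a => (φ.commutes a).symm
  have hsmul (f : MvPolynomial σ K) (a : L) : f • a = aeval x f * a := rfl
  let δ : Derivation K (MvPolynomial σ K) L := mkDerivation K v
  have hδG (i : σ) : δ (G i) = 0 := by
    rw [derivation_eq_sum_pderiv]
    simpa [δ, mkDerivation_X, hsmul, Matrix.mulVec, dotProduct] using congrFun hMv i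
  have hδI : ∀ f ∈ I, δ f = 0 := fun f hf => by
    induction hf using Submodule.span_induction with
    | mem f hf => obtain ⟨i, rfl⟩ := hf; exact hδG i
    | zero => exact map_zero δ
    | add f g _ _ hf hg => rw [map_add, hf, hg, add_zero]
    -- Both Leibniz terms vanish, since `δ f = 0` and `f` vanishes at `x`.
    | smul c f hf' hf => rw [smul_eq_mul, δ.leibniz, hf, hsmul f, hI f hf']; simp
  let δ' : Derivation K (MvPolynomial σ K ⧸ I) L :=
    Derivation.mk' ((I.restrictScalars K).liftQ δ.toLinearMap hδI) fun a b => by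
      obtain ⟨f, rfl⟩ := Ideal.Quotient.mk_surjective a
      obtain ⟨g, rfl⟩ := Ideal.Quotient.mk_surjective b
      exact δ.leibniz f g
  have hδ' : δ' = 0 := by
    rw [← δ'.liftKaehlerDifferential_comp, Subsingleton.elim δ'.liftKaehlerDifferential 0]
    ext; simp
  refine hv (funext fun j => ?_)
  have : δ (X j) = δ' (Ideal.Quotient.mk I (X j)) := rfl
  rw [hδ', mkDerivation_X] at this
  exact this

end Jacobian

/-! ### The coordinate ring of a fiber and its points. -/

section Fiber

variable {K : Type*} [Field K]

theorem finite_and_finrank_quotient_map {τ B : Type*} [CommRing B] [Algebra K B]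
    (φ : MvPolynomial τ K →ₐ[K] B) {D : ℕ} (h : IsFreeOfRank φ.toRingHom D) (p : τ → K) :
    Module.Finite K (B ⧸ Ideal.map φ (Ideal.span (Set.range fun i => X i - C (p i)))) ∧
      Module.finrank K (B ⧸ Ideal.map φ (Ideal.span (Set.range fun i => X i - C (p i)))) = D := by
  set I : Ideal (MvPolynomial τ K) := Ideal.span (Set.range fun i => X i - C (p i))
  let : Algebra (MvPolynomial τ K) B := φ.toAlgebra
  obtain ⟨_, _, hD⟩ :
    Module.Free (MvPolynomial τ K) B ∧ Module.Finite (MvPolynomial τ K) B ∧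
      Module.finrank (MvPolynomial τ K) B = D := h
  have : IsScalarTower K (MvPolynomial τ K) B :=
    .of_algebraMap_eq fun a => (φ.commutes a).symm
  have hI : I ≤ RingHom.ker (aeval (R := K) p) := Ideal.span_le.mpr (by rintro _ ⟨i, rfl⟩; simp)
  have : Nontrivial (MvPolynomial τ K ⧸ I) :=
    Ideal.Quotient.nontrivial_iff.mpr (ne_top_of_le_ne_top (RingHom.ker_ne_top _) hI)
  -- Modulo `I` each variable equals `p i`, so every `f` is congruent to the constant `f(p)`.
  have hsurj : Function.Surjective (Algebra.ofId K (MvPolynomial τ K ⧸ I)) := by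
    have : Ideal.Quotient.mkₐ K I = (Algebra.ofId K _).comp (aeval (R := K) p) := by
      ext i
      have : X i - C (p i) ∈ I := Ideal.subset_span ⟨i, rfl⟩
      rw [AlgHom.comp_apply, aeval_X]
      exact Ideal.Quotient.eq.mpr this
    intro a
    obtain ⟨f, rfl⟩ := Ideal.Quotient.mkₐ_surjective K I a
    exact ⟨_, (DFunLike.congr_fun this f).symm⟩
  let e := AlgEquiv.ofBijective (Algebra.ofId K (MvPolynomial τ K ⧸ I))
    ⟨RingHom.injective _, hsurj⟩
  have h1 : Module.finrank K (MvPolynomial τ K ⧸ I) = 1 := by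
    rw [← e.toLinearEquiv.finrank_eq, Module.finrank_self]
  have : Module.Finite K (MvPolynomial τ K ⧸ I) := .equiv e.toLinearEquiv
  let q := (Algebra.TensorProduct.quotIdealMapEquivQuotTensor B I).toLinearEquiv
  have : Module.Finite (MvPolynomial τ K ⧸ I) (B ⧸ I.map (algebraMap _ B)) := .equiv q.symm
  have : Module.Free (MvPolynomial τ K ⧸ I) (B ⧸ I.map (algebraMap _ B)) := .of_equiv q.symm
  have : IsScalarTower K (MvPolynomial τ K ⧸ I)
      (B ⧸ I.map (algebraMap (MvPolynomial τ K) B)) :=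
    ⟨fun a x y => by
      obtain ⟨f, rfl⟩ := Ideal.Quotient.mk_surjective x
      obtain ⟨b, rfl⟩ := Ideal.Quotient.mk_surjective y
      exact congrArg (Ideal.Quotient.mk (I.map (algebraMap (MvPolynomial τ K) B)))
        (smul_assoc a f b)⟩
  refine ⟨Module.Finite.trans (R := K) (MvPolynomial τ K ⧸ I) (B ⧸ I.map (algebraMap _ B)), ?_⟩
  have := Module.finrank_mul_finrank K (MvPolynomial τ K ⧸ I) (B ⧸ I.map (algebraMap _ B))
  rw [h1, one_mul, q.finrank_eq, Module.finrank_baseChange, hD] at this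
  exact this.symm

variable {n d s : ℕ} {V : Set (AffSpace K n)}
  {F : Fin s → MvPolynomial (Fin n) K} (hF : Ideal.span (Set.range F) = vanishingIdeal K V)
  (Y : Fin d → MvPolynomial (Fin n) K) (p : Fin d → K)

include hF in
theorem finite_and_finrank_fiberIdeal {D : ℕ} (h : IsFreeOfRank (comorphism V Y) D) :
    Module.Finite K (MvPolynomial (Fin n) K ⧸ fiberIdeal F Y p) ∧
      Module.finrank K (MvPolynomial (Fin n) K ⧸ fiberIdeal F Y p) = D := by
  obtain ⟨_, hD⟩ := finite_and_finrank_quotient_map (B := CoordRing V)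
    (aeval fun i => Ideal.Quotient.mk (vanishingIdeal K V) (Y i)) h p
  set J := Ideal.span (Set.range fun i => Y i - C (p i))
  have hJ : Ideal.map (aeval (R := K) fun i => Ideal.Quotient.mk (vanishingIdeal K V) (Y i))
      (Ideal.span (Set.range fun i => X i - C (p i))) =
      J.map (Ideal.Quotient.mkₐ K (vanishingIdeal K V)) := by
    rw [Ideal.map_span, Ideal.map_span, ← Set.range_comp, ← Set.range_comp]
    congr 2
    ext i
    simp
    rfl
  have hI : fiberIdeal F Y p = vanishingIdeal K V ⊔ J := by rw [← hF, fiberIdeal]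
  let e := ((Ideal.quotientEquivAlgOfEq K hJ).trans
    (DoubleQuot.quotQuotEquivQuotSupₐ K (vanishingIdeal K V) J)).trans
    (Ideal.quotientEquivAlgOfEq K hI.symm)
  exact ⟨.equiv e.toLinearEquiv, e.toLinearEquiv.finrank_eq ▸ hD⟩

theorem IsKVariety.zeroLocus_vanishingIdeal (hV : IsKVariety V) :
    zeroLocus (AlgebraicClosure K) (vanishingIdeal K V) = V := by
  obtain ⟨S, hS⟩ := hV
  refine (zeroLocus_vanishingIdeal_le V).antisymm' fun x hx => ?_
  rw [hS]
  exact fun f hf => hx f fun y hy => by rw [hS] at hy; exact hy f hf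

include hF in
theorem fiber_eq_zeroLocus (hV : IsKVariety V) :
    fiber V Y p = zeroLocus (AlgebraicClosure K) (fiberIdeal F Y p) := by
  have h : zeroLocus (AlgebraicClosure K) (fiberIdeal F Y p) =
      zeroLocus (AlgebraicClosure K) (vanishingIdeal K V) ∩
        zeroLocus (AlgebraicClosure K) (Ideal.span (Set.range fun i => Y i - C (p i))) := by
    rw [fiberIdeal, hF]
    exact zeroLocus_vanishingIdeal_galoisConnection.l_sup
  rw [h, hV.zeroLocus_vanishingIdeal, zeroLocus_span]
  ext x
  simp [fiber, sub_eq_zero]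

/-- Points of the zero locus of `I` correspond to `K`-algebra maps out of `K[X] ⧸ I`. -/
noncomputable def zeroLocusEquivAlgHom {σ : Type*} (I : Ideal (MvPolynomial σ K)) (L : Type*) [Field L]
    [Algebra K L] : zeroLocus L I ≃ ((MvPolynomial σ K ⧸ I) →ₐ[K] L) where
  toFun x := Ideal.Quotient.liftₐ I (aeval x.1) x.2
  invFun φ := ⟨fun i => φ (Ideal.Quotient.mkₐ K I (X i)), fun f hf => by
    have : aeval (fun i => φ (Ideal.Quotient.mkₐ K I (X i))) =
      φ.comp (Ideal.Quotient.mkₐ K I) := by ext i; simp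
    rw [this, AlgHom.comp_apply, Ideal.Quotient.mkₐ_eq_mk,
      Ideal.Quotient.eq_zero_iff_mem.mpr hf, map_zero]⟩
  left_inv x := by
    ext i
    exact aeval_X _ i
  right_inv φ := by
    refine Ideal.Quotient.algHom_ext _ ?_
    ext i
    exact aeval_X _ i

include hF in
theorem encard_fiber (hV : IsKVariety V) :
    (fiber V Y p).encard = (Set.univ : Set ((MvPolynomial (Fin n) K ⧸ fiberIdeal F Y p) →ₐ[K]
      AlgebraicClosure K)).encard := by
  rw [fiber_eq_zeroLocus hF Y p hV, Set.encard_univ]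
  exact ENat.card_congr (zeroLocusEquivAlgHom _ _)

end Fiber

theorem fiberIdeal_eq_span_range_append {K : Type*} [Field K] {n d s : ℕ}
    (F : Fin s → MvPolynomial (Fin n) K) (Y : Fin d → MvPolynomial (Fin n) K) (p : Fin d → K) :
    fiberIdeal F Y p = Ideal.span (Set.range (Fin.append (fun i => Y i - C (p i)) F)) := by
  rw [fiberIdeal, ← Ideal.span_union, Set.union_comm]
  congr 1
  ext f
  constructor
  · rintro (⟨i, rfl⟩ | ⟨i, rfl⟩)
    · exact ⟨Fin.castAdd s i, Fin.append_left _ _ i⟩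
    · exact ⟨Fin.natAdd d i, Fin.append_right _ _ i⟩
  · rintro ⟨i, rfl⟩
    induction i using Fin.addCases <;> simp

/-- The shifts by `p i` are constants, so one determinant serves the square systems of all fibers.
-/
theorem jacobianDet_eq_det_append_sub {K : Type*} [Field K] {d s : ℕ}
    (Y : Fin d → MvPolynomial (Fin (d + s)) K) (F : Fin s → MvPolynomial (Fin (d + s)) K)
    (p : Fin d → K) :
    jacobianDet Y F =
      (Matrix.of fun i j => pderiv j (Fin.append (fun i => Y i - C (p i)) F i)).det := by
  rw [jacobianDet]
  congr 2
  ext i j : 2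
  induction i using Fin.addCases <;> simp

theorem isLiftingPoint_iff_formallyUnramified {K : Type*} [Field K] {d s : ℕ}
    {V : Set (AffSpace K (d + s))} (hV : IsKVariety V)
    {F : Fin s → MvPolynomial (Fin (d + s)) K}
    (hF : Ideal.span (Set.range F) = vanishingIdeal K V)
    (Y : Fin d → MvPolynomial (Fin (d + s)) K) (p : Fin d → K) :
    IsLiftingPoint V F Y p ↔
      Algebra.FormallyUnramified K (MvPolynomial (Fin (d + s)) K ⧸ fiberIdeal F Y p) := by
  rw [IsLiftingPoint, fiber_eq_zeroLocus hF Y p hV, fiberIdeal_eq_span_range_append,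
    jacobianDet_eq_det_append_sub Y F p, zeroLocus_span]
  refine ⟨fun h => formallyUnramified_of_aeval_det_ne_zero (L := AlgebraicClosure K) _
    fun x hx => h x (Set.forall_mem_range.mpr hx), fun _ x hx =>
    aeval_det_ne_zero_of_formallyUnramified _ (Set.forall_mem_range.mp hx)⟩

end LiftingFiber

/-- Here `n = d + s`, so that `d = n - s`. -/
theorem proposition4p6 {K : Type*} [Field K] [PerfectField K] {d s : ℕ}
    (V : Set (LiftingFiber.AffSpace K (d + s))) (hV : LiftingFiber.IsKVariety V)
    (hdim : LiftingFiber.IsEquidimensional V d)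
    (F : Fin s → MvPolynomial (Fin (d + s)) K)
    (hF : Ideal.span (Set.range F) = MvPolynomial.vanishingIdeal K V)
    (Y : Fin d → MvPolynomial (Fin (d + s)) K) (hY : ∀ i, (Y i).IsHomogeneous 1)
    (hfin : (LiftingFiber.comorphism V Y).Finite)
    (D : ℕ) (hfree : LiftingFiber.IsFreeOfRank (LiftingFiber.comorphism V Y) D)
    (p : Fin d → K) :
    (LiftingFiber.fiber V Y p).encard ≤ D ∧
      ((LiftingFiber.fiber V Y p).encard = D ↔ LiftingFiber.IsLiftingPoint V F Y p) ∧
      (LiftingFiber.IsLiftingPoint V F Y p ↔ (LiftingFiber.fiberIdeal F Y p).IsRadical) := by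
  obtain ⟨_, hD⟩ := LiftingFiber.finite_and_finrank_fiberIdeal hF Y p hfree
  rw [LiftingFiber.isLiftingPoint_iff_formallyUnramified hV hF, LiftingFiber.encard_fiber hF Y p hV,
    Ideal.isRadical_iff_quotient_reduced, ← hD]
  refine ⟨LiftingFiber.encard_algHom_le_finrank _, ⟨fun h => ?_, fun _ =>
    LiftingFiber.encard_algHom_eq_finrank _⟩, fun _ =>
    Algebra.FormallyUnramified.isReduced_of_field K _, fun _ =>
    LiftingFiber.formallyUnramified_of_isReduced⟩
  have := LiftingFiber.isReduced_of_encard_algHom_eq h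
  exact LiftingFiber.formallyUnramified_of_isReduced
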